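/- Let $n\ge 2$. For a connected graph $G$ on a vertex set $V$ with $|V|=n$, let $\mathcal D(G)$ be its distance matrix, whose $(i,j)$ entry is the length of a shortest path from $i$ to $j$. A real number $\lambda$ is a distance Pareto eigenvalue of $G$ if there is a nonzero entrywise nonnegative vector $x\in\mathbb R^{V}$ with $$\mathcal D(G)x\ge \lambda x \ \text{ (entrywise)}\qquad\text{and}\qquad \lambda=\frac{x^{T}\mathcal D(G)x}{x^{T}x}.$$ Let $\rho_2(G)$ denote the second largest distance Pareto eigenvalue of $G$, multiplicities not being counted. Then $\rho_2(T)$ exists for every tree $T$ of order $n$, and among all trees of order $n$ it attains its minimum at the star $S_n=K_{1,n-1}$, and only there: $\rho_2(T)\ge\rho_2(S_n)$ for every tree $T$ of order $n$, and $\rho_2(T)=\rho_2(S_n)$ only if $T$ is isomorphic to $S_n$. -/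

import Mathlib

/-- `l` is a Pareto eigenvalue of the real square matrix `A`: some nonzero vector `x ≥ 0`
satisfies `A x ≥ l x` (entrywise) and `l = (xᵀ A x) / (xᵀ x)`. -/
def IsParetoEigenvalue {V : Type*} [Fintype V] (A : Matrix V V ℝ) (l : ℝ) : Prop :=
  ∃ x : V → ℝ, x ≠ 0 ∧ 0 ≤ x ∧ l • x ≤ A.mulVec x ∧
    l = dotProduct x (A.mulVec x) / dotProduct x x

/-- The distance matrix of a (connected) graph: its `(i, j)` entry is the length of a shortest
path from `i` to `j`. -/
noncomputable def distanceMatrix {V : Type*} (G : SimpleGraph V) : Matrix V V ℝ :=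
  Matrix.of fun i j => (G.dist i j : ℝ)

/-- The set of all distance Pareto eigenvalues of a graph. -/
def distanceParetoSpectrum {V : Type*} [Fintype V] (G : SimpleGraph V) : Set ℝ :=
  {l | IsParetoEigenvalue (distanceMatrix G) l}

/-- `r` is the `k`-th largest distance Pareto eigenvalue of `G` (for `k ≥ 1`, multiplicities not
counted): it is a distance Pareto eigenvalue, and exactly `k - 1` of them are larger. -/
def IsKthLargestDistancePareto {V : Type*} [Fintype V] (G : SimpleGraph V) (k : ℕ) (r : ℝ) :
    Prop :=
  r ∈ distanceParetoSpectrum G ∧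
    {s | s ∈ distanceParetoSpectrum G ∧ r < s}.encard + 1 = (k : ℕ∞)

/-- The `k`-th largest distance Pareto eigenvalue is unique if it exists. -/
theorem IsKthLargestDistancePareto.unique {V : Type*} [Fintype V] {G : SimpleGraph V} {k : ℕ}
    {r r' : ℝ} (h : IsKthLargestDistancePareto G k r) (h' : IsKthLargestDistancePareto G k r') :
    r = r' := by
  have key : ∀ a b : ℝ, IsKthLargestDistancePareto G k a → IsKthLargestDistancePareto G k b →
      ¬ a < b := by
    intro a b ha hb hab
    have hfin : {s | s ∈ distanceParetoSpectrum G ∧ b < s}.Finite := by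
      rw [← Set.encard_ne_top_iff]
      intro htop
      have h2 := hb.2
      rw [htop] at h2
      simp at h2
    have hss : {s | s ∈ distanceParetoSpectrum G ∧ b < s} ⊂
        {s | s ∈ distanceParetoSpectrum G ∧ a < s} := by
      refine ⟨fun s hs => ⟨hs.1, hab.trans hs.2⟩, fun hsub => ?_⟩
      exact lt_irrefl b (hsub (show b ∈ _ from ⟨hb.1, hab⟩)).2
    have hlt := hfin.encard_lt_encard hss
    have heq := hb.2.trans ha.2.symm
    have := (WithTop.add_right_inj (by simp : (1 : ℕ∞) ≠ ⊤)).1 heq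
    exact hlt.ne this
  rcases lt_trichotomy r r' with hl | he | hg
  · exact (key _ _ h h' hl).elim
  · exact he
  · exact (key _ _ h' h hg).elim

/-! For a nonnegative matrix, Pareto eigenvalues are the `l` with `A x = l x` on the support of some
nonzero `x ≥ 0`. If `A` is symmetric with zero diagonal and positive off-diagonal entries, all
full-support vectors share one eigenvalue, and it strictly exceeds the others
(`IsParetoPair.exists_lt`). So `ρ₂` is the maximum Rayleigh quotient over nonnegative vectors with a
zero coordinate.

In the star all distances are at most 2, so deleting a vertex leaves row sums at most `2 (n - 2)`,
with equality when the centre is deleted.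

If a tree is not a star, take a leaf `u` with neighbour `v` and delete `v`. Compared with all
distances being 2, the `n - 1 - d v` edges missing `v` each lose 1, while `u` gains at least 1
towards each of the `n - 1 - d v` vertices not adjacent to `v`. The all-ones vector thus already
reaches `2 (n - 2)`, and extra weight on `u` makes the bound strict
(`SimpleGraph.IsTree.lt_of_degree_add_one_lt`). -/

open Matrix in
/-- `x` is a nonzero nonnegative vector with `A x = l x` on the support of `x`. -/
def IsParetoPair {V : Type*} [Fintype V] (A : Matrix V V ℝ) (l : ℝ) (x : V → ℝ) : Prop :=
  x ≠ 0 ∧ 0 ≤ x ∧ ∀ i, x i ≠ 0 → (A *ᵥ x) i = l * x i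

/-! ### Pareto eigenvalues and Rayleigh quotients -/

section Pareto

open Matrix

variable {V : Type*} [Fintype V] {A : Matrix V V ℝ} {l m : ℝ} {x y : V → ℝ}

lemma dotProduct_self_pos_of_ne_zero (hx : x ≠ 0) : 0 < x ⬝ᵥ x :=
  lt_of_le_of_ne (Finset.sum_nonneg fun i _ => mul_self_nonneg (x i))
    (fun h => hx (dotProduct_self_eq_zero.1 h.symm))

/-- Complementary slackness: the terms `x j * ((A x) j - l * x j)` are nonnegative and sum to zero,
so each vanishes. Off the support the inequality is free because `A ≥ 0`. -/
theorem isParetoEigenvalue_iff (hA : ∀ i j, 0 ≤ A i j) :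
    IsParetoEigenvalue A l ↔ ∃ x, IsParetoPair A l x := by
  constructor
  · rintro ⟨x, hx, hx0, hle, hl⟩
    refine ⟨x, hx, hx0, fun i hi => ?_⟩
    have hsum : ∑ j, x j * ((A *ᵥ x) j - l * x j) = 0 := by
      have hne := (dotProduct_self_pos_of_ne_zero hx).ne'
      rw [eq_div_iff hne] at hl
      simp only [dotProduct] at hl
      simp only [mul_sub, Finset.sum_sub_distrib]
      rw [← hl, Finset.mul_sum, sub_eq_zero]
      exact Finset.sum_congr rfl fun j _ => by ring
    have h := (Finset.sum_eq_zero_iff_of_nonneg (fun j _ =>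
      mul_nonneg (hx0 j) (sub_nonneg.2 (hle j)))).1 hsum i (Finset.mem_univ i)
    rcases mul_eq_zero.1 h with h | h
    · exact absurd h hi
    · exact sub_eq_zero.1 h
  · rintro ⟨x, hx, hx0, hE⟩
    refine ⟨x, hx, hx0, fun i => ?_, ?_⟩
    · by_cases hi : x i = 0
      · simp only [Pi.smul_apply, hi, smul_zero]
        exact Finset.sum_nonneg fun j _ => mul_nonneg (hA i j) (hx0 j)
      · exact (hE i hi).ge
    · rw [eq_div_iff (dotProduct_self_pos_of_ne_zero hx).ne']
      rw [dotProduct, dotProduct, Finset.mul_sum]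
      refine Finset.sum_congr rfl fun j _ => ?_
      by_cases hj : x j = 0
      · simp [hj]
      · rw [hE j hj]; ring

/-- The support of a Pareto eigenvector of a symmetric matrix determines the eigenvalue. -/
theorem IsParetoPair.eq_of_support_eq (hA : A.IsSymm) (hx : IsParetoPair A l x)
    (hy : IsParetoPair A m y) (h : ∀ i, x i = 0 ↔ y i = 0) : l = m := by
  -- By symmetry `yᵀ A x` equals both `l (yᵀ x)` and `m (yᵀ x)`, and `yᵀ x > 0` on a common support.
  have h1 : y ⬝ᵥ A *ᵥ x = l * (y ⬝ᵥ x) := by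
    simp only [dotProduct, Finset.mul_sum]
    refine Finset.sum_congr rfl fun j _ => ?_
    by_cases hj : y j = 0
    · simp [hj]
    · rw [hx.2.2 j (fun h' => hj ((h j).1 h'))]; ring
  have h2 : x ⬝ᵥ A *ᵥ y = m * (y ⬝ᵥ x) := by
    simp only [dotProduct, Finset.mul_sum]
    refine Finset.sum_congr rfl fun j _ => ?_
    by_cases hj : x j = 0
    · simp [hj]
    · rw [hy.2.2 j (fun h' => hj ((h j).2 h'))]; ring
  have h3 : y ⬝ᵥ A *ᵥ x = x ⬝ᵥ A *ᵥ y := by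
    rw [dotProduct_mulVec, ← mulVec_transpose, hA.eq, dotProduct_comm]
  have hpos : 0 < y ⬝ᵥ x := by
    obtain ⟨i, hi⟩ := Function.ne_iff.1 hx.1
    have hyi : y i ≠ 0 := fun h' => hi ((h i).2 h')
    refine Finset.sum_pos' (fun j _ => mul_nonneg (hy.2.1 j) (hx.2.1 j))
      ⟨i, Finset.mem_univ i, mul_pos ?_ ?_⟩
    · exact lt_of_le_of_ne (hy.2.1 i) hyi.symm
    · exact lt_of_le_of_ne (hx.2.1 i) (Ne.symm hi)
  rw [h1, h2] at h3
  exact mul_right_cancel₀ hpos.ne' h3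

/-- A symmetric entrywise nonnegative matrix has finitely many Pareto eigenvalues. -/
theorem finite_setOf_isParetoEigenvalue (hA : A.IsSymm) (h0 : ∀ i j, 0 ≤ A i j) :
    {l | IsParetoEigenvalue A l}.Finite := by
  have hex : ∀ l : {l | IsParetoEigenvalue A l}, ∃ x, IsParetoPair A l x :=
    fun l => (isParetoEigenvalue_iff h0).1 l.2
  choose f hf using hex
  refine Set.finite_coe_iff.1 (Finite.of_injective (fun l => {i | f l i = 0}) fun a b hab => ?_)
  exact Subtype.ext ((hf a).eq_of_support_eq hA (hf b) fun i => Set.ext_iff.1 hab i)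

/-- Among nonnegative vectors vanishing off a nonempty set `S`, the Rayleigh quotient attains its
maximum. -/
theorem exists_forall_rayleigh_le (A : Matrix V V ℝ) {S : Set V} (hS : S.Nonempty) :
    ∃ x : V → ℝ, ∃ l : ℝ, x ≠ 0 ∧ 0 ≤ x ∧ (∀ i ∉ S, x i = 0) ∧ x ⬝ᵥ A *ᵥ x = l * (x ⬝ᵥ x) ∧
      ∀ y : V → ℝ, 0 ≤ y → (∀ i ∉ S, y i = 0) → y ⬝ᵥ A *ᵥ y ≤ l * (y ⬝ᵥ y) := by
  classical
  set K : Set (V → ℝ) := {x | 0 ≤ x ∧ (∀ i ∉ S, x i = 0) ∧ x ⬝ᵥ x = 1} with hK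
  have hcl : IsClosed K := by
    refine IsClosed.inter isClosed_Ici (IsClosed.inter ?_ ?_)
    · have h : {x : V → ℝ | ∀ i ∉ S, x i = 0} = ⋂ i, ⋂ (_ : i ∉ S), {x | x i = 0} := by
        ext; simp
      change IsClosed {x : V → ℝ | ∀ i ∉ S, x i = 0}
      rw [h]
      exact isClosed_iInter fun i => isClosed_iInter fun _ =>
        isClosed_eq (continuous_apply i) continuous_const
    · exact isClosed_eq (by simp only [dotProduct]; fun_prop) continuous_const
  have hcomp : IsCompact K := by
    refine (isCompact_Icc (a := (0 : V → ℝ)) (b := 1)).of_isClosed_subset hcl fun x hx =>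
      ⟨hx.1, fun i => ?_⟩
    have h : x i * x i ≤ x ⬝ᵥ x :=
      Finset.single_le_sum (f := fun j => x j * x j) (fun j _ => mul_self_nonneg (x j))
        (Finset.mem_univ i)
    rw [hx.2.2] at h
    have := hx.1 i
    simp only [Pi.zero_apply, Pi.one_apply] at *
    nlinarith
  have hne : K.Nonempty := by
    obtain ⟨s, hs⟩ := hS
    refine ⟨Pi.single s 1, Pi.single_nonneg.2 zero_le_one, fun i hi => ?_, by simp⟩
    exact Pi.single_eq_of_ne (by rintro rfl; exact hi hs) _
  obtain ⟨x, hx, hmax⟩ := hcomp.exists_isMaxOn hne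
    (f := fun x => x ⬝ᵥ A *ᵥ x) (by simp only [dotProduct, mulVec]; fun_prop)
  refine ⟨x, x ⬝ᵥ A *ᵥ x, ?_, hx.1, hx.2.1, by rw [hx.2.2, mul_one], fun y hy hyS => ?_⟩
  · rintro rfl
    simpa using hx.2.2
  · by_cases hy0 : y = 0
    · simp [hy0]
    have hp := dotProduct_self_pos_of_ne_zero hy0
    set r := Real.sqrt (y ⬝ᵥ y) with hr
    have hrp : 0 < r := Real.sqrt_pos.2 hp
    have hrr : r * r = y ⬝ᵥ y := Real.mul_self_sqrt hp.le
    have hmem : r⁻¹ • y ∈ K := by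
      refine ⟨smul_nonneg (inv_nonneg.2 hrp.le) hy, fun i hi => by simp [hyS i hi], ?_⟩
      rw [smul_dotProduct, dotProduct_smul, ← hrr]
      simp only [smul_eq_mul]
      field_simp
    have h := isMaxOn_iff.1 hmax _ hmem
    simp only [mulVec_smul, smul_dotProduct, dotProduct_smul, smul_eq_mul] at h
    rw [← hrr]
    have h2 := mul_le_mul_of_nonneg_right h (mul_pos hrp hrp).le
    calc y ⬝ᵥ A *ᵥ y = r⁻¹ * (r⁻¹ * (y ⬝ᵥ A *ᵥ y)) * (r * r) := by field_simp
      _ ≤ _ := h2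

/-- A maximizer of the Rayleigh quotient over the nonnegative vectors vanishing off `S` has
support `S` and is a Pareto eigenvector. -/
theorem isParetoPair_of_forall_rayleigh_le (hA : A.IsSymm) (h0 : ∀ i, A i i = 0)
    (hpos : ∀ i j, i ≠ j → 0 < A i j) {S : Set V} (hx : x ≠ 0) (hx0 : 0 ≤ x)
    (hxS : ∀ i ∉ S, x i = 0) (hl : x ⬝ᵥ A *ᵥ x = l * (x ⬝ᵥ x))
    (hmax : ∀ y : V → ℝ, 0 ≤ y → (∀ i ∉ S, y i = 0) → y ⬝ᵥ A *ᵥ y ≤ l * (y ⬝ᵥ y)) :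
    IsParetoPair A l x ∧ ∀ i ∈ S, x i ≠ 0 := by
  classical
  have hle : ∀ i ∈ S, (A *ᵥ x) i ≤ l * x i := by
    intro i hi
    -- First variation along `x + t eᵢ`; the zero diagonal leaves no `t²` term on the left.
    have key : ∀ t : ℝ, 0 < t → 2 * ((A *ᵥ x) i - l * x i) ≤ t * l := by
      intro t ht
      have h := hmax (x + t • Pi.single i 1)
        (add_nonneg hx0 (smul_nonneg ht.le (Pi.single_nonneg.2 zero_le_one)))
        (fun j hj => by
          have : j ≠ i := fun h => hj (h ▸ hi)
          simp [hxS j hj, this])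
      have hs : x ⬝ᵥ A *ᵥ Pi.single i 1 = (A *ᵥ x) i := by
        rw [dotProduct_mulVec, ← mulVec_transpose, hA.eq]; simp
      simp only [mulVec_add, mulVec_smul, add_dotProduct, dotProduct_add, smul_dotProduct,
        dotProduct_smul, hs, hl, smul_eq_mul, single_dotProduct, dotProduct_single, one_mul,
        mul_one] at h
      have hii : (A *ᵥ Pi.single i 1) i = 0 := by simp [h0]
      simp only [hii, Pi.add_apply, Pi.smul_apply, Pi.single_eq_same, smul_eq_mul] at h
      have : t * (2 * ((A *ᵥ x) i - l * x i)) ≤ t * (t * l) := by nlinarith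
      exact le_of_mul_le_mul_left this ht
    by_contra hcon
    push Not at hcon
    have hd : 0 < (A *ᵥ x) i - l * x i := by linarith
    -- This `t` keeps `t * l` at most the gap, whereas `key` demands at least twice the gap.
    have h1 := key (((A *ᵥ x) i - l * x i) / (|l| + 1)) (by positivity)
    have h2 : ((A *ᵥ x) i - l * x i) / (|l| + 1) * l ≤ (A *ᵥ x) i - l * x i := by
      rw [div_mul_eq_mul_div, div_le_iff₀ (by positivity)]
      nlinarith [le_abs_self l]
    linarith
  have hnn : ∀ i j, 0 ≤ A i j := fun i j => by
    by_cases h : i = j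
    · rw [h, h0]
    · exact (hpos i j h).le
  refine ⟨⟨hx, hx0, fun i hi => ?_⟩, fun i hi hxi => ?_⟩
  · have hsum : ∑ j, x j * (l * x j - (A *ᵥ x) j) = 0 := by
      simp only [dotProduct] at hl
      simp only [mul_sub, Finset.sum_sub_distrib]
      rw [hl, Finset.mul_sum, sub_eq_zero]
      exact Finset.sum_congr rfl fun j _ => by ring
    have h := (Finset.sum_eq_zero_iff_of_nonneg (fun j _ => by
      by_cases hj : j ∈ S
      · exact mul_nonneg (hx0 j) (sub_nonneg.2 (hle j hj))
      · simp [hxS j hj])).1 hsum i (Finset.mem_univ i)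
    rcases mul_eq_zero.1 h with h | h
    · exact absurd h hi
    · linarith
  · obtain ⟨j, hj⟩ := Function.ne_iff.1 hx
    have hij : i ≠ j := by rintro rfl; exact hj hxi
    have h1 := hle i hi
    rw [hxi, mul_zero] at h1
    have h2 : 0 < (A *ᵥ x) i :=
      Finset.sum_pos' (fun k _ => mul_nonneg (hnn i k) (hx0 k))
        ⟨j, Finset.mem_univ j, mul_pos (hpos i j hij) (lt_of_le_of_ne (hx0 j) (Ne.symm hj))⟩
    linarith

/-- A Pareto eigenvector with a zero coordinate never belongs to the largest Pareto eigenvalue. -/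
theorem IsParetoPair.exists_lt (hA : A.IsSymm) (h0 : ∀ i, A i i = 0)
    (hpos : ∀ i j, i ≠ j → 0 < A i j) (hx : IsParetoPair A l x) {v : V} (hv : x v = 0) :
    ∃ y m, IsParetoPair A m y ∧ (∀ i, y i ≠ 0) ∧ l < m := by
  obtain ⟨y, m, hy, hy0, hyS, hm, hmax⟩ := exists_forall_rayleigh_le A (S := Set.univ) ⟨v, trivial⟩
  have hyp := isParetoPair_of_forall_rayleigh_le hA h0 hpos hy hy0 hyS hm hmax
  refine ⟨y, m, hyp.1, fun i => hyp.2 i trivial, ?_⟩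
  have hl : x ⬝ᵥ A *ᵥ x = l * (x ⬝ᵥ x) := by
    simp only [dotProduct, Finset.mul_sum]
    refine Finset.sum_congr rfl fun j _ => ?_
    by_cases hj : x j = 0
    · simp [hj]
    · rw [hx.2.2 j hj]; ring
  have hle : l ≤ m := by
    have h := hmax x hx.2.1 (by simp)
    rw [hl] at h
    exact le_of_mul_le_mul_right h (dotProduct_self_pos_of_ne_zero hx.1)
  refine lt_of_le_of_ne hle ?_
  rintro rfl
  -- If `l = m`, then `x` is itself a global maximizer, so it cannot vanish at `v`.
  exact (isParetoPair_of_forall_rayleigh_le hA h0 hpos hx.1 hx.2.1 (by simp) hl hmax).2 v trivial hv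

/-- The Rayleigh quotient of a nonnegative vector with a zero coordinate is at most some Pareto
eigenvalue with an eigenvector vanishing at that coordinate. -/
theorem exists_isParetoPair_rayleigh_le (hA : A.IsSymm) (h0 : ∀ i, A i i = 0)
    (hpos : ∀ i j, i ≠ j → 0 < A i j) (hx : x ≠ 0) (hx0 : 0 ≤ x) {v : V} (hv : x v = 0) :
    ∃ y m, IsParetoPair A m y ∧ y v = 0 ∧ x ⬝ᵥ A *ᵥ x ≤ m * (x ⬝ᵥ x) := by
  obtain ⟨j, hj⟩ := Function.ne_iff.1 hx
  have hjv : j ≠ v := by rintro rfl; exact hj hv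
  obtain ⟨y, m, hy, hy0, hyS, hm, hmax⟩ := exists_forall_rayleigh_le A (S := {v}ᶜ) ⟨j, hjv⟩
  exact ⟨y, m, (isParetoPair_of_forall_rayleigh_le hA h0 hpos hy hy0 hyS hm hmax).1,
    hyS v (by simp), hmax x hx0 (by simpa using hv)⟩

end Pareto

/-! ### Second largest distance Pareto eigenvalue; the star -/

section Distance

open Matrix

variable {V : Type*} {G : SimpleGraph V}

lemma distanceMatrix_isSymm : (distanceMatrix G).IsSymm :=
  Matrix.ext fun i j => by simp [distanceMatrix, SimpleGraph.dist_comm]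

lemma distanceMatrix_self (i : V) : distanceMatrix G i i = 0 := by
  simp [distanceMatrix]

lemma distanceMatrix_nonneg (i j : V) : 0 ≤ distanceMatrix G i j := by
  simp [distanceMatrix]

lemma SimpleGraph.Connected.distanceMatrix_pos (hG : G.Connected) {i j : V} (h : i ≠ j) :
    0 < distanceMatrix G i j := by
  simpa [distanceMatrix] using hG.pos_dist_of_ne h

lemma SimpleGraph.Connected.two_le_distanceMatrix (hG : G.Connected) {i j : V} (h : i ≠ j)
    (hadj : ¬ G.Adj i j) : 2 ≤ distanceMatrix G i j := by
  have := hG.one_lt_dist_of_ne_of_not_adj h hadj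
  simp only [distanceMatrix, Matrix.of_apply]
  exact_mod_cast this

lemma SimpleGraph.Connected.three_le_distanceMatrix (hG : G.Connected) {i j : V} (h : i ≠ j)
    (hadj : ¬ G.Adj i j) (hc : G.commonNeighbors i j = ∅) : 3 ≤ distanceMatrix G i j := by
  have h2 := SimpleGraph.two_lt_edist_iff.2 ⟨h, hadj, hc⟩
  rw [← (hG i j).coe_dist_eq_edist] at h2
  have h3 : 2 < G.dist i j := by exact_mod_cast h2
  simp only [distanceMatrix, Matrix.of_apply]
  exact_mod_cast h3

variable [Fintype V]

lemma isKthLargestDistancePareto_two_iff {r : ℝ} :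
    IsKthLargestDistancePareto G 2 r ↔
      r ∈ distanceParetoSpectrum G ∧ ∃! m, m ∈ distanceParetoSpectrum G ∧ r < m := by
  refine and_congr_right fun _ => ?_
  have h2 : ((2 : ℕ) : ℕ∞) = 1 + 1 := by norm_num
  rw [h2, (ENat.add_left_injective_of_ne_top ENat.one_ne_top).eq_iff, Set.encard_eq_one]
  constructor
  · rintro ⟨m, hm⟩
    exact ⟨m, (Set.ext_iff.1 hm m).2 rfl, fun y hy => (Set.ext_iff.1 hm y).1 hy⟩
  · rintro ⟨m, hm, hu⟩
    exact ⟨m, Set.ext fun y => ⟨fun hy => hu y hy, by rintro rfl; exact hm⟩⟩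

lemma mem_distanceParetoSpectrum_iff {l : ℝ} :
    l ∈ distanceParetoSpectrum G ↔ ∃ x, IsParetoPair (distanceMatrix G) l x :=
  isParetoEigenvalue_iff distanceMatrix_nonneg

/-- A connected graph with at least two vertices has a second largest distance Pareto
eigenvalue. -/
theorem SimpleGraph.Connected.exists_isKthLargestDistancePareto_two (hG : G.Connected)
    (hn : 2 ≤ Fintype.card V) : ∃ r, IsKthLargestDistancePareto G 2 r := by
  classical
  have hfin : (distanceParetoSpectrum G).Finite :=
    finite_setOf_isParetoEigenvalue distanceMatrix_isSymm distanceMatrix_nonneg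
  -- The non-maximal eigenvalues: of two distinct eigenvalues above `max B`, the smaller would lie
  -- in `B`.
  set B := {l | l ∈ distanceParetoSpectrum G ∧ ∃ m ∈ distanceParetoSpectrum G, l < m} with hB
  have hBfin : B.Finite := hfin.subset fun l hl => hl.1
  have hBne : B.Nonempty := by
    obtain ⟨a, b, hab⟩ := Fintype.exists_pair_of_one_lt_card (α := V) hn
    have hp : IsParetoPair (distanceMatrix G) 0 (Pi.single a 1) := by
      refine ⟨by simp, Pi.single_nonneg.2 zero_le_one, fun i hi => ?_⟩
      have : i = a := by
        by_contra h
        exact hi (Pi.single_eq_of_ne h _)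
      subst this
      simp [distanceMatrix_self]
    obtain ⟨y, m, hy, -, hlt⟩ := hp.exists_lt distanceMatrix_isSymm distanceMatrix_self
      (fun i j => hG.distanceMatrix_pos) (Pi.single_eq_of_ne hab.symm _)
    exact ⟨0, mem_distanceParetoSpectrum_iff.2 ⟨_, hp⟩, m,
      mem_distanceParetoSpectrum_iff.2 ⟨_, hy⟩, hlt⟩
  obtain ⟨r, hr, hmax⟩ := Set.exists_max_image B id hBfin hBne
  obtain ⟨m, hm, hrm⟩ := hr.2
  have hno : ∀ s t, s ∈ distanceParetoSpectrum G → t ∈ distanceParetoSpectrum G → r < s →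
      ¬ s < t := fun s t hs ht hrs hst => absurd (hmax s ⟨hs, t, ht, hst⟩) (not_le.2 hrs)
  refine ⟨r, isKthLargestDistancePareto_two_iff.2 ⟨hr.1, m, ⟨hm, hrm⟩, ?_⟩⟩
  rintro t ⟨ht, hrt⟩
  exact le_antisymm (not_lt.1 (hno m t hm ht hrm)) (not_lt.1 (hno t m ht hm hrt))

/-- A value attained or exceeded by the Rayleigh quotient of a nonnegative vector with a zero
coordinate bounds the second largest distance Pareto eigenvalue from below. -/
theorem SimpleGraph.Connected.lt_of_isKthLargestDistancePareto_two (hG : G.Connected)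
    {r s : ℝ} (hr : IsKthLargestDistancePareto G 2 r) {x : V → ℝ} (hx : x ≠ 0) (hx0 : 0 ≤ x)
    {v : V} (hv : x v = 0) (hs : s * (x ⬝ᵥ x) < x ⬝ᵥ distanceMatrix G *ᵥ x) : s < r := by
  obtain ⟨y, m, hy, hyv, hle⟩ := exists_isParetoPair_rayleigh_le distanceMatrix_isSymm
    distanceMatrix_self (fun i j => hG.distanceMatrix_pos) hx hx0 hv
  obtain ⟨z, t, hz, -, hlt⟩ := hy.exists_lt distanceMatrix_isSymm distanceMatrix_self
    (fun i j => hG.distanceMatrix_pos) hyv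
  have hsm : s < m := lt_of_mul_lt_mul_right (hs.trans_le hle)
    (dotProduct_self_pos_of_ne_zero hx).le
  by_contra hrs
  push Not at hrs
  -- If `r ≤ s`, both `m` and `t` would be eigenvalues above `r`, yet `m < t`.
  have hu := (isKthLargestDistancePareto_two_iff.1 hr).2
  exact hlt.ne (hu.unique ⟨mem_distanceParetoSpectrum_iff.2 ⟨y, hy⟩, hrs.trans_lt hsm⟩
    ⟨mem_distanceParetoSpectrum_iff.2 ⟨z, hz⟩, (hrs.trans_lt hsm).trans hlt⟩)

/-- The second largest distance Pareto eigenvalue of the star of order `n ≥ 2` is `2 (n - 2)`. -/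
theorem isKthLargestDistancePareto_two_starGraph (hn : 2 ≤ Fintype.card V) (c : V) :
    IsKthLargestDistancePareto (SimpleGraph.starGraph c) 2 (2 * ((Fintype.card V : ℝ) - 2)) := by
  classical
  have hG := SimpleGraph.connected_starGraph c
  have hle : ∀ i j, distanceMatrix (SimpleGraph.starGraph c) i j ≤ 2 := fun i j => by
    have h1 : ∀ k, (SimpleGraph.starGraph c).dist k c ≤ 1 := fun k => by
      by_cases h : k = c
      · simp [h]
      · exact (SimpleGraph.dist_eq_one_iff_adj.2 (SimpleGraph.starGraph_center_adj' (Ne.symm h))).le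
    have h2 := hG.dist_triangle (u := i) (v := c) (w := j)
    have h3 := h1 j
    rw [SimpleGraph.dist_comm] at h3
    simp only [distanceMatrix, Matrix.of_apply]
    exact_mod_cast h2.trans (add_le_add (h1 i) h3)
  have hbound : ∀ l x, IsParetoPair (distanceMatrix (SimpleGraph.starGraph c)) l x →
      ∀ v, x v = 0 → l ≤ 2 * ((Fintype.card V : ℝ) - 2) := by
    intro l x hx v hv
    have : Nonempty V := ⟨c⟩
    -- In the row of a largest entry, the terms at `i` and `v` vanish and the others are at most `2
    -- * x i`.
    obtain ⟨i, hi⟩ := Finite.exists_max x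
    obtain ⟨k, hk⟩ := Function.ne_iff.1 hx.1
    have hxi : 0 < x i := (lt_of_le_of_ne (hx.2.1 k) (Ne.symm hk)).trans_le (hi k)
    have hiv : i ≠ v := by rintro rfl; exact hxi.ne' hv
    have h := hx.2.2 i hxi.ne'
    refine le_of_mul_le_mul_right ?_ hxi
    rw [← h]
    calc ∑ j, distanceMatrix (SimpleGraph.starGraph c) i j * x j
        ≤ ∑ j, (2 * x i - (if j = i then 2 * x i else 0) - if j = v then 2 * x i else 0) := by
          refine Finset.sum_le_sum fun j _ => ?_
          by_cases hji : j = i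
          · subst hji; simp [distanceMatrix_self, hiv]
          by_cases hjv : j = v
          · subst hjv; simp [hv, hji]
          · simp only [hji, hjv, if_false, sub_zero]
            exact mul_le_mul (hle i j) (hi j) (hx.2.1 j) zero_le_two
      _ = 2 * ((Fintype.card V : ℝ) - 2) * x i := by
          simp [Finset.sum_sub_distrib]; ring
  have hstar : IsParetoPair (distanceMatrix (SimpleGraph.starGraph c))
      (2 * ((Fintype.card V : ℝ) - 2)) (fun j => if j = c then 0 else 1) := by
    refine ⟨?_, fun j => by dsimp only [Pi.zero_apply]; split_ifs <;> norm_num, fun i hi => ?_⟩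
    · obtain ⟨a, ha⟩ := Fintype.exists_ne_of_one_lt_card hn c
      exact fun h => by simpa [ha] using congrFun h a
    · have hic : i ≠ c := by simpa using hi
      simp only [hic, if_false, mul_one]
      calc ∑ j, distanceMatrix (SimpleGraph.starGraph c) i j * (if j = c then 0 else 1)
          = ∑ j, ((2 : ℝ) - (if j = i then 2 else 0) - if j = c then 2 else 0) := by
            refine Finset.sum_congr rfl fun j _ => ?_
            by_cases hji : j = i
            · subst hji; simp [distanceMatrix_self, hic]
            by_cases hjc : j = c
            · subst hjc; simp [hji]
            · simp only [hji, hjc, if_false, sub_zero, mul_one]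
              exact le_antisymm (hle i j)
                (hG.two_le_distanceMatrix (Ne.symm hji) (by simp [hic, hjc]))
        _ = 2 * ((Fintype.card V : ℝ) - 2) := by
            simp [Finset.sum_sub_distrib]; ring
  obtain ⟨y, m, hy, hy0, hlt⟩ := hstar.exists_lt distanceMatrix_isSymm distanceMatrix_self
    (fun i j => hG.distanceMatrix_pos) (v := c) (by simp)
  refine isKthLargestDistancePareto_two_iff.2 ⟨mem_distanceParetoSpectrum_iff.2 ⟨_, hstar⟩, m,
    ⟨mem_distanceParetoSpectrum_iff.2 ⟨y, hy⟩, hlt⟩, ?_⟩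
  rintro t ⟨ht, hst⟩
  obtain ⟨z, hz⟩ := mem_distanceParetoSpectrum_iff.1 ht
  -- By `hbound`, an eigenvalue above `2 (n - 2)` has a full-support eigenvector, like `y`.
  refine hz.eq_of_support_eq distanceMatrix_isSymm hy fun i => iff_of_false (fun h => ?_) (hy0 i)
  exact absurd (hbound t z hz i h) (not_le.2 hst)

end Distance

/-! ### Trees that are not stars -/

section Tree

open Matrix

variable {V : Type*} {T : SimpleGraph V}

/-- A tree with a universal vertex is a star. -/
theorem SimpleGraph.IsTree.eq_starGraph (hT : T.IsTree) {v : V} (hv : T.IsUniversal v) :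
    T = SimpleGraph.starGraph v := by
  have hle : SimpleGraph.starGraph v ≤ T := by
    intro a b hab
    rw [SimpleGraph.starGraph_adj] at hab
    rcases hab with ⟨hab, rfl | rfl⟩
    · exact hv hab
    · exact (hv hab.symm).symm
  exact le_antisymm
    ((SimpleGraph.isTree_iff_minimal_connected.1 hT).2 (SimpleGraph.connected_starGraph v) hle) hle

theorem nonempty_starGraph_iso (v c : V) :
    Nonempty (SimpleGraph.starGraph v ≃g SimpleGraph.starGraph c) := by
  classical
  refine ⟨Equiv.swap v c, fun {a b} => ?_⟩
  have h : ∀ a, Equiv.swap v c a = c ↔ a = v := fun a => by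
    rw [← (Equiv.swap v c).apply_eq_iff_eq (x := a), Equiv.swap_apply_left]
  simp [SimpleGraph.starGraph_adj, h]

variable [Fintype V]

open Classical in
/-- A tree with a leaf `u` whose neighbour `v` is not adjacent to all other vertices has second
largest distance Pareto eigenvalue greater than `2 (n - 2)`. -/
theorem SimpleGraph.IsTree.lt_of_degree_add_one_lt (hT : T.IsTree) {u v : V}
    (hu : ∀ w, T.Adj u w ↔ w = v) (hv : T.degree v + 1 < Fintype.card V) {r : ℝ}
    (hr : IsKthLargestDistancePareto T 2 r) : 2 * ((Fintype.card V : ℝ) - 2) < r := by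
  have hG := hT.connected
  have huv : T.Adj u v := (hu v).2 rfl
  have hne : u ≠ v := huv.ne
  set n : ℝ := (Fintype.card V : ℝ) with hn
  set a : V → V → ℝ := fun i j => if T.Adj i j then 1 else 0 with ha
  set d : V → ℝ := fun i => T.degree i with hd
  have hdv : d v + 2 ≤ n := by simp only [hd, hn]; exact_mod_cast hv
  have hd1 : 1 ≤ d v := by
    have : 0 < T.degree v := (T.degree_pos_iff_exists_adj v).2 ⟨u, huv.symm⟩
    simp only [hd]; exact_mod_cast this
  -- The first-order gain `ε (n - 1 - d v)` must beat `ε² (n - 2)`; as `n - 1 - d v ≥ 1`, it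
  -- suffices that `ε (n - 2) < 1`.
  set ε : ℝ := 1 / n with hε
  have hn0 : 0 < n := by linarith
  have hε0 : 0 < ε := by positivity
  set x : V → ℝ := fun j => 1 - (if j = v then 1 else 0) + ε * if j = u then 1 else 0 with hx
  have hxv : x v = 0 := by simp [hx, hne.symm]
  have hxu : x u = 1 + ε := by simp [hx, hne]
  have hx1 : ∀ j, j ≠ v → 1 ≤ x j := fun j hj => by
    simp only [hx, hj, if_false]
    split_ifs <;> linarith
  have hx0 : 0 ≤ x := fun j => by
    by_cases hj : j = v
    · rw [hj, hxv]; rfl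
    · exact zero_le_one.trans (hx1 j hj)
  have hsum : ∀ f : V → ℝ, ∑ j, x j * f j = ∑ j, f j - f v + ε * f u := fun f => by
    simp only [hx, add_mul, sub_mul, Finset.sum_add_distrib, Finset.sum_sub_distrib, one_mul,
      mul_assoc, ← Finset.mul_sum, ite_mul, zero_mul, Finset.sum_ite_eq', Finset.mem_univ, if_true]
  have hsum1 : ∑ j, x j = n - 1 + ε := by
    have := hsum fun _ => 1
    simpa [hn] using this
  have hsq : x ⬝ᵥ x = n - 1 + ε + ε * (1 + ε) := by
    rw [dotProduct, hsum, hsum1, hxv, hxu]; ring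
  have hadeg : ∀ i, ∑ j, a i j = d i := fun i => by
    simp [ha, hd, ← SimpleGraph.card_neighborFinset_eq_degree, SimpleGraph.neighborFinset_eq_filter]
  have hasymm : ∀ i j, a i j = a j i := fun i j => by simp [ha, T.adj_comm]
  have hdsum : ∑ i, d i = 2 * (n - 1) := by
    have h1 := T.sum_degrees_eq_twice_card_edges
    have h2 := hT.card_edgeFinset
    have h3 : (∑ i, T.degree i) + 2 = 2 * Fintype.card V := by omega
    have h4 : ((∑ i, d i) + 2 : ℝ) = 2 * n := by simp only [hd, hn]; exact_mod_cast h3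
    linarith
  have hdu : d u = 1 := by
    have : T.degree u = 1 := T.degree_eq_one_iff_existsUnique_adj.2
      ⟨v, huv, fun w hw => (hu w).1 hw⟩
    simp [hd, this]
  have hau : a v u = 1 := by simp [ha, huv.symm]
  have havv : a v v = 0 := by simp [ha]
  have hauu : a u u = 0 := by simp [ha]
  -- Lower bound for distances off `v`: 0 on the diagonal, 1 on edges, 2 otherwise, raised to 3
  -- between `u` and non-neighbours of `v`, since every path from `u` passes through `v`.
  set L : V → V → ℝ := fun i j => 2 - (if j = i then 2 else 0) - a i j
    + (if i = u then 1 - a v j else 0) + (if j = u then 1 - a v i else 0) with hL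
  have hthree : ∀ j, j ≠ v → j ≠ u → 3 - a v j ≤ distanceMatrix T u j := by
    intro j hjv hju
    have hnadj : ¬ T.Adj u j := fun h => hjv ((hu j).1 h)
    by_cases hvj : T.Adj v j
    · have := hG.two_le_distanceMatrix hju.symm hnadj
      simp only [ha, hvj, if_true]; linarith
    · have := hG.three_le_distanceMatrix hju.symm hnadj (by
        refine Set.eq_empty_iff_forall_notMem.2 fun w hw => hvj ?_
        have hw' := T.mem_commonNeighbors.1 hw
        rw [← (hu w).1 hw'.1]
        exact hw'.2.symm)
      simp only [ha, hvj, if_false]; linarith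
  have hLle : ∀ i j, i ≠ v → j ≠ v → L i j ≤ distanceMatrix T i j := by
    intro i j hi hj
    by_cases hij : j = i
    · subst hij
      by_cases hju : j = u
      · subst hju; simp [hL, distanceMatrix_self, hau, hauu]
      · simp [hL, distanceMatrix_self, hju, ha]
    by_cases hiu : i = u
    · subst hiu
      have h1 : a i j = 0 := by simp [ha, hu, hj]
      have h2 := hthree j hj hij
      simp only [hL, hij, if_false, if_true, h1]; linarith
    by_cases hju : j = u
    · subst hju
      have h1 : a i j = 0 := by rw [hasymm]; simp [ha, hu, hi]
      have h2 := hthree i hi hiu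
      rw [distanceMatrix_isSymm.apply] at h2
      simp only [hL, hij, hiu, if_false, if_true, h1]; linarith
    · simp only [hL, hij, hiu, hju, if_false]
      by_cases hadj : T.Adj i j
      · simp only [ha, hadj, if_true, distanceMatrix, Matrix.of_apply,
          SimpleGraph.dist_eq_one_iff_adj.2 hadj]
        norm_num
      · have := hG.two_le_distanceMatrix (Ne.symm hij) hadj
        simp only [ha, hadj, if_false]; linarith
  have hinner : ∀ i, ∑ j, x j * L i j = 2 * (n - 1 + ε) - 2 * x i - (d i - a v i + ε * a i u)
      + (if i = u then n - 1 - d v else 0) + (1 + ε) * (1 - a v i) := by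
    intro i
    have e1 : ∑ j, x j * a i j = d i - a v i + ε * a i u := by rw [hsum, hadeg, hasymm i v]
    have e2 : ∑ j, x j * (1 - a v j) = n - 1 - d v := by
      simp only [mul_sub, mul_one, Finset.sum_sub_distrib, hsum1]
      rw [hsum, hadeg, havv, hau]; ring
    have e3 : ∑ j, x j * (if i = u then 1 - a v j else 0) = if i = u then n - 1 - d v else 0 := by
      split_ifs
      · exact e2
      · simp
    simp only [hL, mul_add, mul_sub (x _), Finset.sum_add_distrib, Finset.sum_sub_distrib, e1, e3]
    simp only [← Finset.sum_mul, hsum1, mul_ite, mul_zero, Finset.sum_ite_eq', Finset.mem_univ,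
      if_true, hxu]
    ring
  -- Lost edges and gains at `u` cancel at order zero in `ε`; only the last term depends on `d v`.
  have houter : ∑ i, x i * ∑ j, x j * L i j =
      2 * (n - 1 + ε) ^ 2 - 2 * (x ⬝ᵥ x) + 2 * ε * (n - 1 - d v) := by
    simp only [hinner]
    rw [hsum]
    have s2 : ∑ i, a i u = 1 := by simp only [fun i => hasymm i u, hadeg, hdu]
    simp only [Finset.sum_add_distrib, Finset.sum_sub_distrib, ← Finset.mul_sum, hsum1, hdsum,
      hadeg, s2, Finset.sum_ite_eq', Finset.mem_univ, if_true, Finset.sum_const, Finset.card_univ,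
      nsmul_eq_mul, ← hn, hxv, hxu, havv, hau, hauu, hdu, if_neg hne.symm, hsq]
    ring
  have hq : ∑ i, x i * ∑ j, x j * L i j ≤ x ⬝ᵥ distanceMatrix T *ᵥ x := by
    refine Finset.sum_le_sum fun i _ => ?_
    by_cases hi : i = v
    · simp [hi, hxv]
    refine mul_le_mul_of_nonneg_left (Finset.sum_le_sum fun j _ => ?_) (hx0 i)
    by_cases hj : j = v
    · simp [hj, hxv]
    rw [mul_comm]
    exact mul_le_mul_of_nonneg_right (hLle i j hi hj) (hx0 j)
  refine hG.lt_of_isKthLargestDistancePareto_two hr (x := x) ?_ hx0 hxv (lt_of_lt_of_le ?_ hq)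
  · intro h
    have := congrFun h u
    rw [hxu, Pi.zero_apply] at this
    linarith
  · rw [houter, hsq]
    have hεn : ε * n = 1 := by rw [hε]; field_simp
    have h1 : ε * (ε * (n - 2)) < ε * (n - 1 - d v) := by
      refine mul_lt_mul_of_pos_left ?_ hε0
      have : ε * (n - 2) = 1 - 2 * ε := by linear_combination hεn
      linarith
    nlinarith [h1]

/-- A tree of order `n ≥ 2` that is not a star has second largest distance Pareto eigenvalue
greater than `2 (n - 2)`. -/
theorem SimpleGraph.IsTree.eq_starGraph_or_lt (hT : T.IsTree) (hn : 2 ≤ Fintype.card V)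
    {r : ℝ} (hr : IsKthLargestDistancePareto T 2 r) :
    (∃ v, T = SimpleGraph.starGraph v) ∨ 2 * ((Fintype.card V : ℝ) - 2) < r := by
  classical
  have : Nontrivial V := Fintype.one_lt_card_iff_nontrivial.1 hn
  obtain ⟨u, hu⟩ := hT.exists_vert_degree_one_of_nontrivial
  obtain ⟨v, hv, huniq⟩ := T.degree_eq_one_iff_existsUnique_adj.1 hu
  by_cases huv : T.IsUniversal v
  · exact Or.inl ⟨v, hT.eq_starGraph huv⟩
  · refine Or.inr (hT.lt_of_degree_add_one_lt
      (fun w => ⟨huniq w, by rintro rfl; exact hv⟩) ?_ hr)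
    simp only [SimpleGraph.IsUniversal, not_forall] at huv
    obtain ⟨w, hvw, hnadj⟩ := huv
    -- The closed neighbourhood of `v` misses `w`, which gives the degree bound.
    have hsub : insert v (T.neighborFinset v) ⊂ Finset.univ := by
      refine Finset.ssubset_univ_iff.2 fun h => ?_
      have := h ▸ Finset.mem_univ w
      simp [hvw.symm, hnadj] at this
    have hcard := Finset.card_lt_card hsub
    rw [Finset.card_insert_of_notMem (by simp), Finset.card_univ] at hcard
    convert hcard using 2
    rw [SimpleGraph.card_neighborFinset_eq_degree]

end Tree

theorem mainTheorem5 {V : Type*} [Fintype V] (hn : 2 ≤ Fintype.card V) (c : V) :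
    (∀ T : SimpleGraph V, T.IsTree → ∃ r : ℝ, IsKthLargestDistancePareto T 2 r) ∧
    ∃ s : ℝ, IsKthLargestDistancePareto (SimpleGraph.starGraph c) 2 s ∧
      IsLeast {r : ℝ | ∃ T : SimpleGraph V, T.IsTree ∧ IsKthLargestDistancePareto T 2 r} s ∧
      ∀ T : SimpleGraph V, T.IsTree → IsKthLargestDistancePareto T 2 s →
        Nonempty (T ≃g SimpleGraph.starGraph c) := by
  have hstar := isKthLargestDistancePareto_two_starGraph hn
  refine ⟨fun T hT => hT.connected.exists_isKthLargestDistancePareto_two hn, _, hstar c,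
    ⟨⟨_, SimpleGraph.isTree_starGraph c, hstar c⟩, ?_⟩, fun T hT hs => ?_⟩
  · rintro r ⟨T, hT, hr⟩
    rcases hT.eq_starGraph_or_lt hn hr with ⟨v, rfl⟩ | h
    · exact ((hstar v).unique hr).le
    · exact h.le
  · obtain ⟨v, rfl⟩ := (hT.eq_starGraph_or_lt hn hs).resolve_right (lt_irrefl _)
    exact nonempty_starGraph_iso v c
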